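/- All topological spaces are assumed to be Hausdorff. A *gyrogroup* is a set $G$ with a binary operation $\oplus$ having a two-sided identity $0$, a two-sided inverse $\ominus x$ of each $x\in G$, and for all $x,y\in G$ an automorphism $\mathrm{gyr}[x,y]$ of $(G,\oplus)$ such that $x\oplus(y\oplus z)=(x\oplus y)\oplus\mathrm{gyr}[x,y](z)$ for all $z\in G$ and $\mathrm{gyr}[x\oplus y,y]=\mathrm{gyr}[x,y]$. A *topological gyrogroup* is a gyrogroup with a topology for which $\oplus:G\times G\to G$ and $\ominus:G\to G$ are continuous. A nonempty subset $H\subseteq G$ is a *subgyrogroup* if $H$ is a gyrogroup under the operation of $G$ and $\mathrm{gyr}[a,b]$ restricts to an automorphism of $H$ for all $a,b\in H$; it is an *$L$-subgyrogroup* if moreover $\mathrm{gyr}[a,h](H)=H$ for all $a\in G$, $h\in H$. In that case $G/H=\{a\oplus H: a\in G\}$ is a partition of $G$, and it carries the quotient topology of the map $a\mapsto a\oplus H$. A topological property $\mathscr Q$ is a *three-space property in topological gyrogroups* if, whenever $G$ is a topological gyrogroup, $H$ is a closed $L$-subgyrogroup of $G$, and both $H$ (with the subspace topology) and $G/H$ have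 $\mathscr Q$, then $G$ has $\mathscr Q$. **Corollary 4.8.** Each of the following is a three-space property in topological gyrogroups: (a) every sequentially compact subset is closed; (b) every sequentially compact subset is compact; (c) each of the three properties: every compact subset is first-countable; every countably compact subset is first-countable; every sequentially compact subset is first-countable; (d) each of the three properties: every compact subset is metrizable; every countably compact subset is metrizable; every sequentially compact subset is metrizable. Here first-countability and metrizability of a subset refer to its subspace topology. -/

import Mathlib

universe u

/-- A gyrogroup, written additively: `x + y` is the gyrogroup operation, `0` the identity, `-x` the
inverse of `x`, and `gyr x y` the gyration generated by `x` and `y`, an automorphism of `(G, +)`.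
The operation is in general neither associative nor commutative. The identity, the inverses and the
gyrations are all determined by the operation. -/
class Gyrogroup (G : Type u) extends Add G, Zero G, Neg G where
  zero_add' : ∀ a : G, 0 + a = a
  add_zero' : ∀ a : G, a + 0 = a
  neg_add_cancel' : ∀ x : G, -x + x = 0
  add_neg_cancel' : ∀ x : G, x + -x = 0
  gyr : G → G → (G ≃+ G)
  add_gyr_assoc : ∀ x y z : G, x + (y + z) = (x + y) + gyr x y z
  gyr_add_left : ∀ x y : G, gyr (x + y) y = gyr x y

/-- A topological gyrogroup: the operation is jointly continuous and inversion is continuous. -/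
class IsTopologicalGyrogroup (G : Type u) [TopologicalSpace G] [Gyrogroup G] : Prop
    extends ContinuousAdd G, ContinuousNeg G

namespace Gyrogroup

variable {G : Type u} [Gyrogroup G]

/-- A subgyrogroup of `G`: a nonempty subset that is closed under the operation and inversion and on
which every gyration `gyr a b` with `a b ∈ H` restricts to a bijection (hence an automorphism). -/
structure IsSubgyrogroup (H : Set G) : Prop where
  nonempty : H.Nonempty
  add_mem : ∀ a ∈ H, ∀ b ∈ H, a + b ∈ H
  neg_mem : ∀ a ∈ H, -a ∈ H
  gyr_image : ∀ a ∈ H, ∀ b ∈ H, gyr a b '' H = H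

/-- An `L`-subgyrogroup: a subgyrogroup `H` with `gyr[a, h](H) = H` for all `a ∈ G`, `h ∈ H`. -/
structure IsLSubgyrogroup (H : Set G) : Prop extends IsSubgyrogroup H where
  gyr_image_left : ∀ a : G, ∀ h ∈ H, gyr a h '' H = H

/-- The left coset `a ⊕ H`. -/
def leftCoset (H : Set G) (a : G) : Set G := (fun h => a + h) '' H

/-- The coset space `G / H`: two points of `G` are identified when their left cosets are equal. -/
def CosetSpace (H : Set G) : Type u := Quotient (Setoid.ker (leftCoset H))

/-- The canonical projection `G → G / H`. -/
def CosetSpace.mk (H : Set G) (a : G) : CosetSpace H :=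
  Quotient.mk (Setoid.ker (leftCoset H)) a

/-- The quotient topology: `O` is open in `G / H` iff its preimage is open in `G`. -/
instance (H : Set G) [TopologicalSpace G] : TopologicalSpace (CosetSpace H) :=
  TopologicalSpace.coinduced (CosetSpace.mk H) inferInstance

end Gyrogroup

/-- `Q` is a three-space property for (Hausdorff) topological gyrogroups: whenever `H` is a closed
`L`-subgyrogroup of `G` and both the subspace `H` and the quotient space `G / H` have `Q`, so does
`G`. -/
def IsThreeSpaceProperty (Q : (X : Type u) → [TopologicalSpace X] → Prop) : Prop :=
  ∀ (G : Type u) [TopologicalSpace G] [T2Space G] [Gyrogroup G] [IsTopologicalGyrogroup G]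
    (H : Set G), Gyrogroup.IsLSubgyrogroup H → IsClosed H →
    Q H → Q (Gyrogroup.CosetSpace H) → Q G

/-! A subset `K` of `G` is studied through its image in `G / H` and its traces on the cosets `x ⊕
H`. Left translation by `⊖x` carries such a trace into `H`, and the trace is relatively closed in
`K` because `G / H` is Hausdorff; so both inherit the compactness of `K`, and the hypotheses on `G /
H` and `H` apply. `G` itself is regular.

(a) If `x` is in the closure of `K` but not in `K`, a closed neighbourhood `C` of `x` misses the
closed trace of `K` on `x ⊕ H`; yet the image of `K ∩ C` is closed, so it contains the class of `x`.
(b) The projection restricted to `K` is closed with compact fibres, hence proper, and its image is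
compact. (c) Countable bases in the image and in the trace make each point of `K` a `G_δ` in `K`; in
a regular space, countable compactness upgrades this to first countability. (d) By (c), `K` is
sequentially compact and `⊖K ⊕ K` is first countable at `0`. Since `⊖x ⊕ y = 0` only on the
diagonal, the diagonal of `K` has a countable neighbourhood base, so `K` is second countable and
regular, hence metrizable. -/

open Set Filter Topology

namespace Gyrogroup

/-! ### Cancellation laws and cosets -/

section Algebra

variable {G : Type u} [Gyrogroup G]

theorem add_left_cancel' {x a b : G} (h : x + a = x + b) : a = b := by
  have h' : -x + (x + a) = -x + (x + b) := by rw [h]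
  rw [add_gyr_assoc, add_gyr_assoc, neg_add_cancel', zero_add', zero_add'] at h'
  exact (gyr (-x) x).injective h'

theorem gyr_zero_left (x y : G) : gyr 0 x y = y := by
  have h := add_gyr_assoc 0 x y
  rw [zero_add', zero_add'] at h
  exact (add_left_cancel' h).symm

theorem neg_add_cancel_left' (x y : G) : -x + (x + y) = y := by
  rw [add_gyr_assoc, ← gyr_add_left, neg_add_cancel', gyr_zero_left, zero_add']

theorem add_neg_cancel_left' (x y : G) : x + (-x + y) = y := by
  rw [add_gyr_assoc, ← gyr_add_left, add_neg_cancel', gyr_zero_left, zero_add']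

theorem neg_add_eq_zero' {x y : G} : -x + y = 0 ↔ x = y := by
  refine ⟨fun h => ?_, fun h => h ▸ neg_add_cancel' x⟩
  have := add_neg_cancel_left' x y
  rwa [h, add_zero'] at this

/-- The cosubtraction `a ⊟ b = a ⊕ gyr[a, b](⊖b)`. -/
def cosub (a b : G) : G := a + gyr a b (-b)

/-- Eliminates the gyration, which is not assumed continuous; continuity of `cosub` follows. -/
theorem cosub_eq (a b : G) : cosub a b = a + (-(a + b) + a) := by
  have h := add_gyr_assoc a b (-b)
  rw [add_neg_cancel', add_zero'] at h
  have h' := neg_add_cancel_left' (a + b) (gyr a b (-b))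
  rw [← h] at h'
  rw [cosub, h']

theorem add_cosub_cancel (a b : G) : cosub (a + b) b = a := by
  rw [cosub, gyr_add_left, ← add_gyr_assoc, add_neg_cancel', add_zero']

theorem IsSubgyrogroup.zero_mem {H : Set G} (hH : IsSubgyrogroup H) : (0 : G) ∈ H := by
  obtain ⟨h, hh⟩ := hH.nonempty
  simpa [add_neg_cancel'] using hH.add_mem h hh _ (hH.neg_mem h hh)

theorem IsLSubgyrogroup.leftCoset_add {H : Set G} (hH : IsLSubgyrogroup H) (x : G) {h : G}
    (hh : h ∈ H) : leftCoset H (x + h) = leftCoset H x := by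
  ext y
  constructor
  · rintro ⟨z, hz, rfl⟩
    rw [← hH.gyr_image_left x h hh] at hz
    obtain ⟨w, hw, rfl⟩ := hz
    exact ⟨h + w, hH.add_mem h hh w hw, add_gyr_assoc x h w⟩
  · rintro ⟨z, hz, rfl⟩
    refine ⟨gyr x h (-h + z), ?_, ?_⟩
    · rw [← hH.gyr_image_left x h hh]
      exact mem_image_of_mem _ (hH.add_mem _ (hH.neg_mem h hh) _ hz)
    · change x + h + gyr x h (-h + z) = x + z
      rw [← add_gyr_assoc, add_neg_cancel_left']

theorem IsLSubgyrogroup.mk_eq_mk {H : Set G} (hH : IsLSubgyrogroup H) {x y : G} :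
    CosetSpace.mk H x = CosetSpace.mk H y ↔ -x + y ∈ H := by
  have : CosetSpace.mk H x = CosetSpace.mk H y ↔ leftCoset H x = leftCoset H y := Quotient.eq
  rw [this]
  constructor
  · intro h
    have hy : y ∈ leftCoset H x := h ▸ ⟨0, hH.zero_mem, add_zero' y⟩
    obtain ⟨z, hz, rfl⟩ := hy
    simpa [neg_add_cancel_left'] using hz
  · intro h
    rw [← hH.leftCoset_add x h, add_neg_cancel_left']

theorem IsLSubgyrogroup.mk_cosub {H : Set G} (hH : IsLSubgyrogroup H) (x : G) {h : G}
    (hh : h ∈ H) : CosetSpace.mk H (cosub x h) = CosetSpace.mk H x := by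
  refine (hH.mk_eq_mk.2 ?_).symm
  rw [cosub, neg_add_cancel_left', ← hH.gyr_image_left x h hh]
  exact mem_image_of_mem _ (hH.neg_mem h hh)

end Algebra

/-! ### Regularity of `G`, and the projection onto `G / H` -/

section Topological

theorem CosetSpace.continuous_mk {G : Type u} [TopologicalSpace G] [Gyrogroup G] (H : Set G) :
    Continuous (CosetSpace.mk H) :=
  continuous_coinduced_rng

variable {G : Type u} [TopologicalSpace G] [Gyrogroup G] [IsTopologicalGyrogroup G]

theorem continuous_cosub : Continuous fun p : G × G => cosub p.1 p.2 := by
  simp only [cosub_eq]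
  fun_prop

instance (priority := 100) regularSpace : RegularSpace G := by
  refine .of_exists_mem_nhds_isClosed_subset fun x U hU => ?_
  have hx : cosub x 0 = x := by simpa [add_zero'] using add_cosub_cancel x 0
  have h := (continuous_cosub (G := G)).tendsto (x, 0)
  simp only [hx] at h
  obtain ⟨V, hV, W, hW, hVW⟩ := mem_nhds_prod_iff.1 (h hU)
  refine ⟨closure V, mem_of_superset hV subset_closure, isClosed_closure, fun y hy => ?_⟩
  have hW' : (fun z => -y + z) ⁻¹' W ∈ 𝓝 y := by
    have hc : Continuous fun z : G => -y + z := by fun_prop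
    exact hc.tendsto y (by simpa [neg_add_cancel'] using hW)
  -- For `w = -y + v` in `W`, `v = y + w`, so `cosub v w = y` lands in `U`.
  obtain ⟨v, hv, hvV⟩ := mem_closure_iff_nhds.1 hy _ hW'
  have := hVW (mk_mem_prod hvV hv)
  have e := add_cosub_cancel y (-y + v)
  rw [add_neg_cancel_left'] at e
  simpa [e] using this

/-- Openness: for `h ∈ H` the continuous map `z ↦ cosub z h` preserves cosets, and a suitable `h`
sends `y` to a given point of its coset. -/
theorem IsLSubgyrogroup.isOpenQuotientMap_mk {H : Set G} (hH : IsLSubgyrogroup H) :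
    IsOpenQuotientMap (CosetSpace.mk H) where
  surjective := Quotient.mk_surjective
  continuous := CosetSpace.continuous_mk H
  isOpenMap U hU := by
    refine isOpen_coinduced.2 (isOpen_iff_mem_nhds.2 ?_)
    rintro y ⟨x, hx, hxy⟩
    have hm := hH.mk_eq_mk.1 hxy
    have e := add_cosub_cancel x (-x + y)
    rw [add_neg_cancel_left'] at e
    have hc : Continuous fun z : G => cosub z (-x + y) :=
      continuous_cosub.comp (continuous_id.prodMk continuous_const)
    filter_upwards [hc.tendsto y (hU.mem_nhds (by simpa only [e] using hx))] with z hz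
    exact ⟨_, hz, hH.mk_cosub z hm⟩

theorem IsLSubgyrogroup.t2Space_cosetSpace {H : Set G} (hH : IsLSubgyrogroup H)
    (hc : IsClosed H) : T2Space (CosetSpace H) := by
  rw [t2Space_iff_of_isOpenQuotientMap hH.isOpenQuotientMap_mk]
  simp only [hH.mk_eq_mk]
  exact hc.preimage (f := fun p : G × G => -p.1 + p.2) (by fun_prop)

end Topological

end Gyrogroup

open Gyrogroup

/-! ### Countable character and second countability -/

section Topology

theorem exists_seq_nhds_inter_subset_singleton {X : Type*} [TopologicalSpace X] [T1Space X]
    (S : Set X) (x : X) [(𝓝[S] x).IsCountablyGenerated] :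
    ∃ O : ℕ → Set X, (∀ n, O n ∈ 𝓝 x) ∧ ∀ y ∈ S, (∀ n, y ∈ O n) → y = x := by
  obtain ⟨B, hB⟩ := (𝓝[S] x).exists_antitone_basis
  choose O hO hOB using fun n => mem_nhdsWithin_iff_exists_mem_nhds_inter.1 (hB.mem n)
  refine ⟨O, hO, fun y hy h => ?_⟩
  by_contra hne
  obtain ⟨n, hn⟩ := hB.mem_iff.1
    (mem_nhdsWithin_of_mem_nhds (isOpen_ne.mem_nhds (Ne.symm hne)))
  exact hn (hOB n ⟨h n, hy⟩) rfl

theorem isCountablyGenerated_nhdsWithin_of_firstCountable {X : Type*} [TopologicalSpace X]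
    {S : Set X} [FirstCountableTopology S] {x : X} (hx : x ∈ S) :
    (𝓝[S] x).IsCountablyGenerated := by
  rw [← map_nhds_subtype_val ⟨x, hx⟩]
  infer_instance

theorem firstCountableTopology_of_nhdsWithin {X : Type*} [TopologicalSpace X] {S : Set X}
    (h : ∀ x ∈ S, (𝓝[S] x).IsCountablyGenerated) : FirstCountableTopology S := by
  refine ⟨fun x => ?_⟩
  have := h x x.2
  rw [nhds_subtype_eq_comap_nhdsWithin]
  infer_instance

/-- In a regular space, a `G_δ` point of a countably compact subset has countable character
in it. -/
theorem IsCountablyCompact.isCountablyGenerated_nhdsWithin {X : Type*} [TopologicalSpace X]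
    [RegularSpace X] {K : Set X} (hK : IsCountablyCompact K) {x : X} {O : ℕ → Set X}
    (hO : ∀ n, O n ∈ 𝓝 x) (hx : ∀ y ∈ K, (∀ n, y ∈ O n) → y = x) :
    (𝓝[K] x).IsCountablyGenerated := by
  choose C hC hCc hCO using fun n => exists_mem_nhds_isClosed_subset (hO n)
  suffices h : 𝓝[K] x = ⨅ n, 𝓟 (K ∩ C n) by rw [h]; infer_instance
  refine le_antisymm (le_iInf fun n => le_principal_iff.2 ?_) fun U hU => ?_
  · exact inter_mem self_mem_nhdsWithin (mem_nhdsWithin_of_mem_nhds (hC n))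
  obtain ⟨V, hVo, hxV, hVU⟩ := mem_nhdsWithin.1 hU
  by_contra hUf
  have hKf : K ∈ ⨅ n, 𝓟 (K ∩ C n) := mem_iInf_of_mem 0 (mem_principal.2 inter_subset_left)
  have hne : ((⨅ n, 𝓟 (K ∩ C n)) ⊓ 𝓟 Vᶜ).NeBot := by
    refine neBot_iff.2 fun h => ?_
    rw [← mem_iff_inf_principal_compl] at h
    exact hUf (mem_of_superset (inter_mem h hKf) hVU)
  -- A cluster point lies in every `C n`, hence equals `x`, yet it avoids `V`.
  obtain ⟨a, haK, ha⟩ := hK (f := (⨅ n, 𝓟 (K ∩ C n)) ⊓ 𝓟 Vᶜ)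
    (inf_le_left.trans (le_principal_iff.2 hKf))
  have hal : ∀ {T : Set X}, IsClosed T → T ∈ (⨅ n, 𝓟 (K ∩ C n)) ⊓ 𝓟 Vᶜ → a ∈ T :=
    fun hT h => isClosed_iff_clusterPt.1 hT a (ha.mono (le_principal_iff.2 h))
  have haV : a ∈ Vᶜ := hal hVo.isClosed_compl (mem_inf_of_right (mem_principal_self _))
  refine haV (hx a haK (fun n => hCO n (hal (hCc n) (mem_inf_of_left ?_))) ▸ hxV)
  exact mem_iInf_of_mem n (mem_principal.2 inter_subset_right)

theorem IsSeqCompact.of_isClosed_subset {X : Type*} [TopologicalSpace X] {K F : Set X}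
    (hK : IsSeqCompact K) (hF : IsClosed F) (hFK : F ⊆ K) : IsSeqCompact F := by
  intro x hx
  obtain ⟨a, -, φ, hφ, ha⟩ := hK fun n => hFK (hx n)
  exact ⟨a, hF.mem_of_tendsto ha (Eventually.of_forall fun n => hx _), φ, hφ, ha⟩

theorem IsSeqCompact.prod {X Y : Type*} [TopologicalSpace X] [TopologicalSpace Y] {K : Set X}
    {L : Set Y} (hK : IsSeqCompact K) (hL : IsSeqCompact L) : IsSeqCompact (K ×ˢ L) := by
  intro x hx
  obtain ⟨a, ha, φ, hφ, hxa⟩ := hK fun n => (hx n).1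
  obtain ⟨b, hb, ψ, hψ, hxb⟩ := hL fun n => (hx (φ n)).2
  exact ⟨(a, b), ⟨ha, hb⟩, φ ∘ ψ, hφ.comp hψ,
    Tendsto.prodMk_nhds (hxa.comp hψ.tendsto_atTop) hxb⟩

/-- A sequentially compact regular space `X` is second countable if its diagonal is a fibre of a
continuous map `X × X → Y` over a point of countable character in the range. -/
theorem secondCountableTopology_of_fiber_eq_diagonal {X Y : Type*} [TopologicalSpace X]
    [T2Space X] [RegularSpace X] [SeqCompactSpace X] [TopologicalSpace Y] [T2Space Y]
    {f : X × X → Y} (hf : Continuous f) {e : Y} (hfe : ∀ x y, f (x, y) = e ↔ x = y)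
    (he : (𝓝[range f] e).IsCountablyGenerated) : SecondCountableTopology X := by
  obtain ⟨B, hB⟩ := (𝓝[range f] e).exists_antitone_basis
  have hmem : ∀ n, ∃ W : Set Y, IsOpen W ∧ e ∈ W ∧ W ∩ range f ⊆ B n := fun n =>
    mem_nhdsWithin.1 (hB.mem n)
  choose W hWo heW hWB using hmem
  let D : ℕ → Set (X × X) := fun n => f ⁻¹' W n
  have hDo : ∀ n, IsOpen (D n) := fun n => (hWo n).preimage hf
  have hdiag : ∀ n x, (x, x) ∈ D n := fun n x => by
    change f (x, x) ∈ W n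
    rw [(hfe x x).2 rfl]
    exact heW n
  -- The `D n` form a neighbourhood base of the diagonal: pairs escaping `O` subconverge to a point
  -- of the fibre over `e`, that is, of the diagonal.
  have hbase : ∀ O : Set (X × X), IsOpen O → (∀ x, (x, x) ∈ O) → ∃ n, D n ⊆ O := by
    intro O hO hdO
    by_contra! hcon
    choose p hpD hpO using fun n => not_subset.1 (hcon n)
    obtain ⟨⟨a, b⟩, -, φ, hφ, hab⟩ :=
      (isSeqCompact_univ (X := X)).prod (isSeqCompact_univ (X := X))
        (x := p) (fun n => ⟨mem_univ _, mem_univ _⟩)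
    have h1 : Tendsto (fun n => f (p n)) atTop (𝓝 e) :=
      (hB.tendsto fun n => hWB n ⟨hpD n, mem_range_self _⟩).mono_right nhdsWithin_le_nhds
    have h2 := (hf.tendsto (a, b)).comp hab
    have h3 : a = b := (hfe a b).1
      (tendsto_nhds_unique h2 (h1.comp hφ.tendsto_atTop))
    subst h3
    exact hO.isClosed_compl.mem_of_tendsto hab (Eventually.of_forall fun n => hpO _) (hdO a)
  -- Total boundedness: otherwise some sequence has no pair of terms in `D n`, though consecutive
  -- terms of a convergent subsequence approach the diagonal.
  have hfin : ∀ n, ∃ A : Set X, A.Finite ∧ ∀ x, ∃ a ∈ A, (a, x) ∈ D n := by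
    intro n
    by_contra! hcon
    choose g hg using fun A : Finset X => hcon A A.finite_toSet
    obtain ⟨s, hs⟩ : ∃ s : ℕ → X, ∀ m, ∀ k < m, (s k, s m) ∉ D n := by
      obtain ⟨s, hs⟩ := exists_seq_of_forall_finset_exists (fun _ : X => True)
        (fun a x => (a, x) ∉ D n) fun A _ =>
          ⟨g A, trivial, fun a ha => hg A a (Finset.mem_coe.2 ha)⟩
      exact ⟨s, fun m k h => hs.2 k m h⟩
    obtain ⟨a, φ, hφ, ha⟩ := SeqCompactSpace.tendsto_subseq s
    have h1 : Tendsto (fun i => (s (φ i), s (φ (i + 1)))) atTop (𝓝 (a, a)) :=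
      ha.prodMk_nhds (ha.comp (tendsto_add_atTop_nat 1))
    obtain ⟨i, hi⟩ := (h1.eventually ((hDo n).mem_nhds (hdiag n a))).exists
    exact hs _ _ (hφ i.lt_succ_self) hi
  choose A hA hAD using hfin
  let 𝓑 : Set (Set X) := ⋃ n, (fun a => {y | (a, y) ∈ D n}) '' A n
  have h𝓑 : TopologicalSpace.IsTopologicalBasis 𝓑 := by
    refine TopologicalSpace.isTopologicalBasis_of_isOpen_of_nhds ?_ fun x U hxU hU => ?_
    · rintro _ hs
      obtain ⟨n, a, -, rfl⟩ := mem_iUnion.1 hs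
      exact (hDo n).preimage (by fun_prop : Continuous fun y => (a, y))
    have hsep : ∀ V : Set X, IsOpen V → x ∈ V → ∃ C : Set X, C ∈ 𝓝 x ∧
        ∃ n, ∀ a y, (a, y) ∈ D n → (a ∈ C → y ∈ V) ∧ (y ∈ C → a ∈ V) := by
      intro V hV hxV
      obtain ⟨C, hC, hCc, hCV⟩ := exists_mem_nhds_isClosed_subset (hV.mem_nhds hxV)
      obtain ⟨n, hn⟩ := hbase (V ×ˢ V ∪ Cᶜ ×ˢ Cᶜ)
        ((hV.prod hV).union (hCc.isOpen_compl.prod hCc.isOpen_compl)) fun y => by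
          by_cases hy : y ∈ C
          · exact Or.inl ⟨hCV hy, hCV hy⟩
          · exact Or.inr ⟨hy, hy⟩
      refine ⟨C, hC, n, fun a y h => ?_⟩
      rcases hn h with h' | h'
      · exact ⟨fun _ => h'.2, fun _ => h'.1⟩
      · exact ⟨fun ha => (h'.1 ha).elim, fun hy => (h'.2 hy).elim⟩
    -- Two passes, as in a triangle inequality: from `x` to the centre `a`, then from `a` to `y`.
    obtain ⟨C, hC, n, hn⟩ := hsep U hU hxU
    obtain ⟨C', hC', m, hm⟩ := hsep (interior C) isOpen_interior
      (mem_interior_iff_mem_nhds.2 hC)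
    obtain ⟨k, hk⟩ := hbase (D n ∩ D m) ((hDo n).inter (hDo m)) fun x => ⟨hdiag n x, hdiag m x⟩
    obtain ⟨a, haA, hax⟩ := hAD k x
    refine ⟨_, mem_iUnion.2 ⟨k, a, haA, rfl⟩, hax, fun y hy => ?_⟩
    exact (hn a y (hk hy).1).1
      (interior_subset ((hm a x (hk hax).2).2 (mem_of_mem_nhds hC')))
  exact h𝓑.secondCountableTopology
    (countable_iUnion fun n => ((hA n).image _).countable)

end Topology

/-! ### Notions of compactness -/

/-- The common features of compactness, countable compactness and sequential compactness used
for three-space properties. -/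
structure IsCompactnessNotion (P : (X : Type u) → [TopologicalSpace X] → Set X → Prop) :
    Prop where
  isCountablyCompact : ∀ {X : Type u} [TopologicalSpace X] {K : Set X}, P X K →
    IsCountablyCompact K
  image : ∀ {X Y : Type u} [TopologicalSpace X] [TopologicalSpace Y] {K : Set X} {f : X → Y},
    P X K → Continuous f → P Y (f '' K)
  of_isClosed_subset : ∀ {X : Type u} [TopologicalSpace X] {K F : Set X}, P X K → IsClosed F →
    F ⊆ K → P X F
  of_image_val : ∀ {X : Type u} [TopologicalSpace X] {S : Set X} {K : Set S},
    P X (Subtype.val '' K) → P S K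
  -- Sequential compactness is demanded because countable compactness alone is not productive.
  image_prod : ∀ {X Y : Type u} [TopologicalSpace X] [TopologicalSpace Y] {K : Set X}
    {f : X × X → Y}, P X K → IsSeqCompact K → Continuous f → P Y (f '' K ×ˢ K)

theorem isCompactnessNotion_isCompact :
    IsCompactnessNotion.{u} fun _ _ K => IsCompact K where
  isCountablyCompact h := h.isCountablyCompact
  image h hf := h.image hf
  of_isClosed_subset h hF hFK := h.of_isClosed_subset hF hFK
  of_image_val h := Subtype.isCompact_iff.2 h
  image_prod h _ hf := (h.prod h).image hf

theorem isCompactnessNotion_isCountablyCompact :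
    IsCompactnessNotion.{u} fun _ _ K => IsCountablyCompact K where
  isCountablyCompact h := h
  image h hf := h.image hf
  of_isClosed_subset h hF hFK := h.of_isClosed_subset hF hFK
  of_image_val h := Subtype.isCountablyCompact_iff.2 h
  image_prod _ h hf := ((h.prod h).image hf.seqContinuous).isCountablyCompact

theorem isCompactnessNotion_isSeqCompact :
    IsCompactnessNotion.{u} fun _ _ K => IsSeqCompact K where
  isCountablyCompact h := h.isCountablyCompact
  image h hf := h.image hf.seqContinuous
  of_isClosed_subset h hF hFK := h.of_isClosed_subset hF hFK
  of_image_val h := Subtype.isSeqCompact_iff.2 h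
  image_prod h _ hf := (h.prod h).image hf.seqContinuous

/-! ### Traces on cosets -/

namespace Gyrogroup

/-- The trace of `K` on the coset `x ⊕ H`, translated to a subset of `H`. -/
def cosetTrace {G : Type u} [Gyrogroup G] (H K : Set G) (x : G) : Set H := {h | x + (h : G) ∈ K}

theorem image_cosetTrace {G : Type u} [Gyrogroup G] {H : Set G} (hH : IsLSubgyrogroup H) (K : Set G) (x : G) :
    (fun h : H => x + (h : G)) '' cosetTrace H K x =
      K ∩ CosetSpace.mk H ⁻¹' {CosetSpace.mk H x} := by
  ext y
  constructor
  · rintro ⟨h, hh, rfl⟩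
    refine ⟨hh, (hH.mk_eq_mk.2 ?_).symm⟩
    rw [neg_add_cancel_left']
    exact h.2
  · rintro ⟨hy, hyx⟩
    refine ⟨⟨-x + y, hH.mk_eq_mk.1 (Eq.symm hyx)⟩, ?_, add_neg_cancel_left' x y⟩
    change x + (-x + y) ∈ K
    rwa [add_neg_cancel_left']

variable {G : Type u} [TopologicalSpace G] [Gyrogroup G] [IsTopologicalGyrogroup G] {H : Set G}

theorem isClosed_preimage_mk_singleton (hH : IsLSubgyrogroup H) (hc : IsClosed H) (x : G) :
    IsClosed (CosetSpace.mk H ⁻¹' {CosetSpace.mk H x}) :=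
  have := hH.t2Space_cosetSpace hc
  isClosed_singleton.preimage (CosetSpace.continuous_mk H)

/-- `K` need not be closed in `X`, so the closed-subset axiom is applied inside the subspace `K` and
the result pushed forward. -/
theorem _root_.IsCompactnessNotion.inter_isClosed
    {P : (X : Type u) → [TopologicalSpace X] → Set X → Prop} (hP : IsCompactnessNotion P)
    {X : Type u} [TopologicalSpace X] {K F : Set X} (hK : P X K) (hF : IsClosed F) :
    P X (K ∩ F) := by
  have h := hP.of_isClosed_subset (F := Subtype.val ⁻¹' F) (K := (univ : Set K))
    (hP.of_image_val (by simpa using hK)) (hF.preimage continuous_subtype_val) (subset_univ _)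
  simpa using hP.image h continuous_subtype_val

theorem _root_.IsCompactnessNotion.of_cosetTrace
    {P : (X : Type u) → [TopologicalSpace X] → Set X → Prop} (hP : IsCompactnessNotion P)
    (hH : IsLSubgyrogroup H) (hc : IsClosed H) {K : Set G} (hK : P G K) (x : G) :
    P H (cosetTrace H K x) := by
  refine hP.of_image_val ?_
  have h := hP.image (hP.inter_isClosed hK (isClosed_preimage_mk_singleton hH hc x))
    (by fun_prop : Continuous fun y : G => -x + y)
  rw [← image_cosetTrace hH, image_image] at h
  simpa only [neg_add_cancel_left'] using h

end Gyrogroup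

/-! ### The three-space properties -/

theorem isThreeSpaceProperty_isClosed_of_isSeqCompact :
    IsThreeSpaceProperty.{u} fun X _ => ∀ K : Set X, IsSeqCompact K → IsClosed K := by
  intro G _ _ _ _ H hH hc hQH hQ K hK
  have hP := isCompactnessNotion_isSeqCompact.{u}
  refine isClosed_of_closure_subset fun x hx => ?_
  by_contra hxK
  have hF : IsClosed (K ∩ CosetSpace.mk H ⁻¹' {CosetSpace.mk H x}) := by
    have h := hc.isClosedEmbedding_subtypeVal.isClosedMap _
      (hQH _ (hP.of_cosetTrace hH hc hK x))
    convert h.preimage (by fun_prop : Continuous fun y : G => -x + y) using 1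
    rw [← image_cosetTrace hH]
    ext y
    constructor
    · rintro ⟨h, hh, rfl⟩
      exact ⟨h, hh, (neg_add_cancel_left' x h).symm⟩
    · rintro ⟨h, hh, hy : (h : G) = -x + y⟩
      exact ⟨h, hh, by simp only [hy, add_neg_cancel_left']⟩
  obtain ⟨C, hC, hCc, hCF⟩ := exists_mem_nhds_isClosed_subset
    (hF.isOpen_compl.mem_nhds fun h : x ∈ _ => hxK h.1)
  have hcl := hQ _ (hP.image (hP.inter_isClosed hK hCc) (CosetSpace.continuous_mk H))
  have hx' : x ∈ closure (K ∩ C) := by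
    refine mem_closure_iff_nhds.2 fun U hU => ?_
    obtain ⟨y, hy, hyK⟩ := mem_closure_iff_nhds.1 hx _ (inter_mem hU hC)
    exact ⟨y, hy.1, hyK, hy.2⟩
  obtain ⟨y, hy, hyx⟩ := hcl.closure_subset
    (image_closure_subset_closure_image (CosetSpace.continuous_mk H) (mem_image_of_mem _ hx'))
  exact hCF hy.2 ⟨hy.1, hyx⟩

theorem isThreeSpaceProperty_isCompact_of_isSeqCompact :
    IsThreeSpaceProperty.{u} fun X _ => ∀ K : Set X, IsSeqCompact K → IsCompact K := by
  intro G _ _ _ _ H hH hc hQH hQ K hK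
  have hP := isCompactnessNotion_isSeqCompact.{u}
  have := hH.t2Space_cosetSpace hc
  have hf : Continuous (K.domRestrict (CosetSpace.mk H)) :=
    (CosetSpace.continuous_mk H).comp continuous_subtype_val
  have huniv : IsSeqCompact (univ : Set K) := isSeqCompact_iff_isSeqCompact_univ.1 hK
  have hproper : IsProperMap (K.domRestrict (CosetSpace.mk H)) := by
    refine isProperMap_iff_isClosedMap_and_compact_fibers.2 ⟨hf, fun F hF => ?_, fun y => ?_⟩
    · exact (hQ _ (hP.image (huniv.of_isClosed_subset hF (subset_univ _)) hf)).isClosed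
    · obtain ⟨x, rfl⟩ := hH.isOpenQuotientMap_mk.surjective y
      have h := (hQH _ (hP.of_cosetTrace hH hc hK x)).image
        (by fun_prop : Continuous fun h : H => x + (h : G))
      rw [image_cosetTrace hH] at h
      rw [Subtype.isCompact_iff]
      convert h using 1
      exact Subtype.image_preimage_coe K (CosetSpace.mk H ⁻¹' {CosetSpace.mk H x})
  have h := hproper.isCompact_preimage (hQ _ (hP.image huniv hf))
  rwa [preimage_image_univ, ← isCompact_iff_isCompact_univ] at h

theorem IsCompactnessNotion.isThreeSpaceProperty_firstCountableTopology
    {P : (X : Type u) → [TopologicalSpace X] → Set X → Prop} (hP : IsCompactnessNotion P) :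
    IsThreeSpaceProperty.{u} fun X _ => ∀ K : Set X, P X K → FirstCountableTopology K := by
  intro G _ _ _ _ H hH hc hQH hQ K hK
  have := hH.t2Space_cosetSpace hc
  refine firstCountableTopology_of_nhdsWithin fun x hx => ?_
  have h1 := hQ _ (hP.image hK (CosetSpace.continuous_mk H))
  have h2 := hQH _ (hP.of_cosetTrace hH hc hK x)
  have h3 := isCountablyGenerated_nhdsWithin_of_firstCountable
    (mem_image_of_mem (CosetSpace.mk H) hx)
  -- The point `0` of the trace corresponds to `x`.
  have h4 := isCountablyGenerated_nhdsWithin_of_firstCountable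
    (show (⟨0, hH.zero_mem⟩ : H) ∈ cosetTrace H K x by
      change x + 0 ∈ K
      rwa [add_zero'])
  obtain ⟨B, hB, hBx⟩ := exists_seq_nhds_inter_subset_singleton
    (CosetSpace.mk H '' K) (CosetSpace.mk H x)
  obtain ⟨C, hC, hC0⟩ := exists_seq_nhds_inter_subset_singleton
    (cosetTrace H K x) ⟨0, hH.zero_mem⟩
  choose V hV hVC using fun n => mem_nhds_subtype _ _ _ |>.1 (hC n)
  refine (hP.isCountablyCompact hK).isCountablyGenerated_nhdsWithin
    (O := fun n => CosetSpace.mk H ⁻¹' B n ∩ (fun y => -x + y) ⁻¹' V n) (fun n => ?_)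
    fun y hy hyO => ?_
  · have hcont : Continuous fun y : G => -x + y := by fun_prop
    exact inter_mem ((CosetSpace.continuous_mk H).tendsto x (hB n))
      (hcont.tendsto x (by simpa [neg_add_cancel'] using hV n))
  · have hxy : CosetSpace.mk H y = CosetSpace.mk H x :=
      hBx _ (mem_image_of_mem _ hy) fun n => (hyO n).1
    have h := hC0 ⟨-x + y, hH.mk_eq_mk.1 hxy.symm⟩
      (by change x + (-x + y) ∈ K; rwa [add_neg_cancel_left'])
      fun n => hVC n (hyO n).2
    exact (neg_add_eq_zero'.1 (congrArg Subtype.val h)).symm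

theorem IsCompactnessNotion.isThreeSpaceProperty_metrizableSpace
    {P : (X : Type u) → [TopologicalSpace X] → Set X → Prop} (hP : IsCompactnessNotion P) :
    IsThreeSpaceProperty.{u} fun X _ =>
      ∀ K : Set X, P X K → TopologicalSpace.MetrizableSpace K := by
  intro G _ _ _ _ H hH hc hQH hQ K hK
  -- Metrizable sets are first-countable, so (c) applies to `K` and later to the set of differences.
  have hfc : ∀ L : Set G, P G L → FirstCountableTopology L :=
    hP.isThreeSpaceProperty_firstCountableTopology G H hH hc
      (fun L hL => have := hQH L hL; inferInstance)
      (fun L hL => have := hQ L hL; inferInstance)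
  have := hfc K hK
  have : CountablyCompactSpace K :=
    isCountablyCompact_iff_countablyCompactSpace.1 (hP.isCountablyCompact hK)
  have hsc : IsSeqCompact K := isSeqCompact_iff_seqCompactSpace.2 inferInstance
  rcases K.eq_empty_or_nonempty with rfl | ⟨x, hx⟩
  · infer_instance
  let f : K × K → G := fun p => -(p.1 : G) + p.2
  have hrange : range f = (fun p : G × G => -p.1 + p.2) '' K ×ˢ K := by
    ext z
    constructor
    · rintro ⟨p, rfl⟩
      exact ⟨(p.1, p.2), ⟨p.1.2, p.2.2⟩, rfl⟩
    · rintro ⟨p, hp, rfl⟩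
      exact ⟨(⟨p.1, hp.1⟩, ⟨p.2, hp.2⟩), rfl⟩
  have := hfc (range f) (hrange ▸ hP.image_prod hK hsc (by fun_prop))
  have : SecondCountableTopology K := secondCountableTopology_of_fiber_eq_diagonal (f := f)
    (by fun_prop) (fun _ _ => neg_add_eq_zero'.trans Subtype.ext_iff.symm)
    (isCountablyGenerated_nhdsWithin_of_firstCountable
      ⟨(⟨x, hx⟩, ⟨x, hx⟩), neg_add_cancel' x⟩)
  infer_instance

theorem corollary4p8 :
    IsThreeSpaceProperty.{u} (fun X _ => ∀ K : Set X, IsSeqCompact K → IsClosed K) ∧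
    IsThreeSpaceProperty.{u} (fun X _ => ∀ K : Set X, IsSeqCompact K → IsCompact K) ∧
    (IsThreeSpaceProperty.{u} (fun X _ => ∀ K : Set X, IsCompact K → FirstCountableTopology K) ∧
      IsThreeSpaceProperty.{u}
        (fun X _ => ∀ K : Set X, IsCountablyCompact K → FirstCountableTopology K) ∧
      IsThreeSpaceProperty.{u}
        (fun X _ => ∀ K : Set X, IsSeqCompact K → FirstCountableTopology K)) ∧
    (IsThreeSpaceProperty.{u}
        (fun X _ => ∀ K : Set X, IsCompact K → TopologicalSpace.MetrizableSpace K) ∧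
      IsThreeSpaceProperty.{u}
        (fun X _ => ∀ K : Set X, IsCountablyCompact K → TopologicalSpace.MetrizableSpace K) ∧
      IsThreeSpaceProperty.{u}
        (fun X _ => ∀ K : Set X, IsSeqCompact K → TopologicalSpace.MetrizableSpace K)) :=
  ⟨isThreeSpaceProperty_isClosed_of_isSeqCompact,
    isThreeSpaceProperty_isCompact_of_isSeqCompact,
    ⟨isCompactnessNotion_isCompact.isThreeSpaceProperty_firstCountableTopology,
      isCompactnessNotion_isCountablyCompact.isThreeSpaceProperty_firstCountableTopology,
      isCompactnessNotion_isSeqCompact.isThreeSpaceProperty_firstCountableTopology⟩,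
    ⟨isCompactnessNotion_isCompact.isThreeSpaceProperty_metrizableSpace,
      isCompactnessNotion_isCountablyCompact.isThreeSpaceProperty_metrizableSpace,
      isCompactnessNotion_isSeqCompact.isThreeSpaceProperty_metrizableSpace⟩⟩
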